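/- Let $T$ be a finite tree with $|T|\ge 1$ vertices. A subtree of $T$ is a nonempty subgraph of $T$ that is itself a tree. Let $\mu(T)$ be the average number of vertices of a subtree of $T$, the average being taken over all subtrees of $T$, and let $D(T)=\mu(T)/|T|$ be the subtree density of $T$. A tree is called series-reduced if it has no vertex of degree $2$. (a) For every finite tree $T$ we have $\frac13\le D(T)\le 1$, and the set of values $\{D(T) : T \text{ a finite tree}\}$ is dense in the interval $[\frac13,1]$. (b) For every finite series-reduced tree $T$ with at least two vertices we have $\frac12\le D(T)\le\frac34$, and the set of values $\{D(T) : T \text{ a finite series-reduced tree with } |T|\ge 2\}$ is dense in the interval $[\frac12,\frac34]$. -/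

import Mathlib

namespace SubtreeDensity

/-- The (finite) set of all subtrees of a finite graph `T`: the subgraphs of `T` that are trees.
Trees are connected, hence nonempty, so the empty subgraph is not a subtree. -/
noncomputable def subtrees {V : Type*} [Finite V] (T : SimpleGraph V) : Finset T.Subgraph :=
  (Set.toFinite {S : T.Subgraph | S.coe.IsTree}).toFinset

/-- The number `N(T)` of subtrees of `T`. -/
noncomputable def numSubtrees {V : Type*} [Finite V] (T : SimpleGraph V) : ℕ :=
  (subtrees T).card

/-- The average subtree order `μ(T)`: the average number of vertices over all subtrees of `T`. -/
noncomputable def meanSubtreeOrder {V : Type*} [Finite V] (T : SimpleGraph V) : ℝ :=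
  (∑ S ∈ subtrees T, (S.verts.ncard : ℝ)) / (numSubtrees T : ℝ)

/-- The subtree density `D(T) = μ(T) / |T|`. -/
noncomputable def density {V : Type*} [Finite V] (T : SimpleGraph V) : ℝ :=
  meanSubtreeOrder T / (Nat.card V : ℝ)

/-- A graph is series-reduced if it has no vertex of degree `2`. -/
def IsSeriesReduced {V : Type*} (T : SimpleGraph V) : Prop :=
  ∀ v : V, (T.neighborSet v).ncard ≠ 2

end SubtreeDensity

/-!
Every tree is obtained from single vertices by repeatedly joining the roots of two rooted trees by
an edge. The numbers of subtrees and of subtrees through the root, and the sums of their orders,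
satisfy recursions under this operation, and the two lower bounds follow by induction.

The lower bound `1 / 2` for series-reduced trees is proved with a leaf as the root, because then
every other vertex has a number of children different from one. The upper bound `3 / 4` holds
because a subtree misses, on average, at least half of the leaves, and a series-reduced tree has
more leaves than other vertices.

For the density of the values, a path on `j` vertices between two stars with `k` leaves has about
`(2 ^ k + j) ^ 2 - j ^ 2 / 2` subtrees, whose mean order ranges over all of `(1 / 3, 1)` (relative
to `j`) as the ratio `2 ^ k / j` varies. In the series-reduced case, attach a star with `k` leaves
to the end of a caterpillar with `2 * l` vertices. An average subtree contains all but boundedly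
many vertices of the spine and about half of the leaves, so the subtree density is close to
`(3 * l + k) / (2 * (2 * l + k))`, which takes all rational values in `[1 / 2, 3 / 4]`.
-/

namespace SubtreeDensity

open Filter Topology

/-- Finite rooted trees, encoded by attaching rooted trees one after the other to a root vertex:
`graft t c` is `t` with the root of `c` added as a further child of the root of `t`. -/
inductive GraftTree where
  | single : GraftTree
  | graft : GraftTree → GraftTree → GraftTree

namespace GraftTree

/-! ### Counting the subtrees of a rooted tree -/

/-- The number of vertices. -/
@[simp] def size : GraftTree → ℕ
  | single => 1
  | graft t c => t.size + c.size

/-- The number of subtrees that contain the root. -/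
@[simp] def rootCount : GraftTree → ℕ
  | single => 1
  | graft t c => t.rootCount * (1 + c.rootCount)

/-- The sum of the orders of the subtrees that contain the root. -/
@[simp] def rootSum : GraftTree → ℕ
  | single => 1
  | graft t c => t.rootSum * (1 + c.rootCount) + t.rootCount * c.rootSum

/-- The number of subtrees. -/
@[simp] def count : GraftTree → ℕ
  | single => 1
  | graft t c => t.count + c.count + t.rootCount * c.rootCount

/-- The sum of the orders of the subtrees. -/
@[simp] def sum : GraftTree → ℕ
  | single => 1
  | graft t c => t.sum + c.sum + (t.rootSum * c.rootCount + t.rootCount * c.rootSum)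

/-- The number of children of the root. -/
@[simp] def numChildren : GraftTree → ℕ
  | single => 0
  | graft t _ => t.numChildren + 1

/-- No vertex other than the root has degree two, that is, exactly one child. -/
@[simp] def Reduced : GraftTree → Prop
  | single => True
  | graft t c => t.Reduced ∧ c.Reduced ∧ c.numChildren ≠ 1

/-- The number of leaves, where the root does not count as a leaf. -/
@[simp] def leafCount : GraftTree → ℕ
  | single => 0
  | graft t single => t.leafCount + 1
  | graft t (graft c d) => t.leafCount + (graft c d).leafCount

lemma size_pos (b : GraftTree) : 0 < b.size := by
  induction b with
  | single => simp
  | graft t c _ _ => simp only [size]; omega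

lemma two_le_size {b : GraftTree} (hb : b ≠ single) : 2 ≤ b.size := by
  cases b with
  | single => simp at hb
  | graft t c => exact Nat.add_le_add t.size_pos c.size_pos

lemma size_le_rootCount (b : GraftTree) : b.size ≤ b.rootCount := by
  induction b with
  | single => simp
  | graft t c ht hc =>
    have h : 1 * c.rootCount ≤ t.rootCount * c.rootCount :=
      Nat.mul_le_mul_right _ (t.size_pos.trans_le ht)
    simp only [size, rootCount]
    linarith

lemma rootCount_pos (b : GraftTree) : 0 < b.rootCount :=
  b.size_pos.trans_le b.size_le_rootCount

lemma rootCount_le_count (b : GraftTree) : b.rootCount ≤ b.count := by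
  induction b with
  | single => simp
  | graft t c ht _ => simp only [rootCount, count]; linarith

lemma count_pos (b : GraftTree) : 0 < b.count :=
  b.rootCount_pos.trans_le b.rootCount_le_count

lemma rootCount_le_rootSum (b : GraftTree) : b.rootCount ≤ b.rootSum := by
  induction b with
  | single => simp
  | graft t c ht _ =>
    exact (Nat.mul_le_mul_right _ ht).trans (Nat.le_add_right _ _)

lemma count_le_rootSum (b : GraftTree) : b.count ≤ b.rootSum := by
  induction b with
  | single => simp
  | graft t c ht hc =>
    have h₁ : t.rootCount * c.rootCount ≤ t.rootSum * c.rootCount :=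
      Nat.mul_le_mul_right _ t.rootCount_le_rootSum
    have h₂ : 1 * c.rootSum ≤ t.rootCount * c.rootSum :=
      Nat.mul_le_mul_right _ t.rootCount_pos
    simp only [count, rootSum]
    linarith

lemma size_add_one_mul_rootCount_le (b : GraftTree) :
    (b.size + 1) * b.rootCount ≤ 2 * b.rootSum := by
  induction b with
  | single => simp
  | graft t c ht hc =>
    have h₁ := Nat.mul_le_mul_right (1 + c.rootCount) ht
    have h₂ := Nat.mul_le_mul_left t.rootCount hc
    have h₃ := Nat.mul_le_mul_left t.rootCount c.size_le_rootCount
    simp only [size, rootCount, rootSum]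
    linarith

/-! ### The lower bound `1 / 3` -/

lemma size_add_two_mul_count_le (b : GraftTree) : (b.size + 2) * b.count ≤ 3 * b.sum := by
  induction b with
  | single => simp
  | graft t c ht hc =>
    have h₁ := Nat.mul_le_mul_right c.rootCount t.size_add_one_mul_rootCount_le
    have h₂ := Nat.mul_le_mul_left t.rootCount c.size_add_one_mul_rootCount_le
    have h₃ := Nat.mul_le_mul c.size_le_rootCount t.count_le_rootSum
    have h₄ := Nat.mul_le_mul t.size_le_rootCount c.count_le_rootSum
    simp only [size, count, sum]
    linarith

/-! ### The upper bound `3 / 4` for series-reduced trees -/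

lemma leafCount_lt_size (b : GraftTree) : b.leafCount < b.size := by
  fun_induction leafCount b with
  | case1 => simp
  | case2 t ht => simpa using ht
  | case3 t c d ht hc => rw [size]; omega

lemma two_mul_rootSum_add_le (b : GraftTree) :
    2 * b.rootSum + b.leafCount * b.rootCount ≤ 2 * (b.size * b.rootCount) := by
  fun_induction leafCount b with
  | case1 => simp
  | case2 t ht => simp only [rootSum, rootCount, size]; linarith
  | case3 t c d ht hc =>
    generalize graft c d = e at hc ⊢
    have h₁ := Nat.mul_le_mul_right (1 + e.rootCount) ht
    have h₂ := Nat.mul_le_mul_left t.rootCount hc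
    have h₃ := Nat.mul_le_mul_left t.rootCount e.leafCount_lt_size.le
    simp only [rootSum, rootCount, size]
    nlinarith

/-- On average, a subtree misses at least half of the leaves. -/
lemma two_mul_sum_add_le (b : GraftTree) :
    2 * b.sum + b.leafCount * b.count ≤ 2 * (b.size * b.count) := by
  fun_induction leafCount b with
  | case1 => simp
  | case2 t ht =>
    have h₁ := t.two_mul_rootSum_add_le
    have h₂ := t.leafCount_lt_size
    have h₃ := t.rootCount_le_count
    simp only [sum, count, size, rootSum, rootCount]
    linarith
  | case3 t c d ht hc =>
    generalize graft c d = e at hc ⊢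
    have h₁ := Nat.mul_le_mul_right e.rootCount t.two_mul_rootSum_add_le
    have h₂ := Nat.mul_le_mul_left t.rootCount e.two_mul_rootSum_add_le
    have h₃ := Nat.mul_le_mul_right e.count t.leafCount_lt_size.le
    have h₄ := Nat.mul_le_mul_right t.count e.leafCount_lt_size.le
    simp only [sum, count, size]
    nlinarith

lemma Reduced.size_add_numChildren_le {b : GraftTree} (h : b.Reduced) :
    b.size + b.numChildren ≤ 2 * b.leafCount + 1 := by
  fun_induction leafCount b with
  | case1 => simp
  | case2 t ht => have := ht h.1; simp only [size, numChildren]; omega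
  | case3 t c d ht hc =>
    have h₁ := ht h.1
    have h₂ := hc h.2.1
    have h₃ : (graft c d).numChildren ≠ 1 := h.2.2
    simp only [size, numChildren] at *
    omega

lemma Reduced.four_mul_sum_le {b : GraftTree} (h : b.Reduced) (hb : 0 < b.numChildren) :
    4 * b.sum ≤ 3 * (b.size * b.count) := by
  have h₁ : b.size ≤ 2 * b.leafCount := by have := h.size_add_numChildren_le; omega
  have h₂ := Nat.mul_le_mul_right b.count h₁
  have h₃ := b.two_mul_sum_add_le
  linarith

/-! ### The lower bound `1 / 2` for series-reduced trees -/

/-- No vertex has exactly one child. Every such tree with more than one vertex arises from two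
smaller ones, either by joining their roots to a new root or by attaching one of them to the root
of the other. -/
inductive Branching : GraftTree → Prop
  | leaf : Branching single
  | join {c d : GraftTree} : Branching c → Branching d → Branching (graft (graft single c) d)
  | attach {t c : GraftTree} : t ≠ single → Branching t → Branching c → Branching (graft t c)

lemma Reduced.branching : ∀ {b : GraftTree}, b.Reduced → b.numChildren ≠ 1 → b.Branching
  | single, _, _ => .leaf
  | graft single _, _, hb => absurd rfl hb
  | graft (graft single _) _, ⟨⟨_, hc, hc₁⟩, hd, hd₁⟩, _ =>
    .join (hc.branching hc₁) (hd.branching hd₁)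
  | graft (graft (graft _ _) _) _, ⟨ht, hc, hc₁⟩, _ =>
    .attach (by simp) (Reduced.branching ht (by simp)) (hc.branching hc₁)

namespace Branching

variable {b : GraftTree}

lemma eq_single_or_eq_cherry_or_le (h : b.Branching) :
    b = single ∨ b = graft (graft single single) single ∨ 2 * b.size ≤ b.rootCount := by
  induction h with
  | leaf => simp
  | @join c d _ _ hc hd =>
    have := c.size_pos
    have := d.size_pos
    rcases hc with rfl | rfl | hc <;> rcases hd with rfl | rfl | hd <;>
      first | tauto | (right; right; simp only [size, rootCount] at *; nlinarith)
  | @attach t c ht _ _ ht' hc =>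
    have := t.size_pos
    have := c.size_pos
    rcases ht' with rfl | rfl | ht' <;> rcases hc with rfl | rfl | hc <;>
      first | tauto | (right; right; simp only [size, rootCount] at *; nlinarith)

lemma two_mul_count_add_size_lt (h : b.Branching) :
    2 * b.count + b.size < 4 * b.rootCount := by
  induction h with
  | leaf => simp
  | @join c d _ _ hc hd =>
    have := c.rootCount_pos
    have := d.rootCount_pos
    simp only [count, size, rootCount]
    nlinarith
  | @attach t c ht _ _ ht' hc =>
    have := (two_le_size ht).trans t.size_le_rootCount
    have := c.rootCount_pos
    simp only [count, size, rootCount]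
    nlinarith

/-- Every `b` in the induction is planted on an additional root: the excess
`2 * sum - size * count` of the planted trees is then, up to a quadratic form in sizes and root
counts, additive with nonnegative corrections coming from the estimates on root subtrees. -/
lemma size_mul_count_graft_single_le (h : b.Branching) :
    (graft single b).size * (graft single b).count ≤ 2 * (graft single b).sum := by
  simp only [size, count, sum, rootSum, rootCount, one_mul]
  induction h with
  | leaf => simp
  | @join c d hc hd ihc ihd =>
    have rootSum_c := Nat.mul_le_mul_left (2 * d.rootCount + 1) c.size_add_one_mul_rootCount_le
    have rootSum_d := Nat.mul_le_mul_left (2 * c.rootCount + 1) d.size_add_one_mul_rootCount_le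
    have count_c := Nat.mul_le_mul_left (d.size + 1) hc.two_mul_count_add_size_lt
    have count_d := Nat.mul_le_mul_left (c.size + 1) hd.two_mul_count_add_size_lt
    have := c.size_pos
    have := d.size_pos
    rcases hc.eq_single_or_eq_cherry_or_le with rfl | rfl | hc' <;>
      rcases hd.eq_single_or_eq_cherry_or_le with rfl | rfl | hd' <;>
      simp only [size, count, sum, rootSum, rootCount] at * <;>
      nlinarith
  | @attach t c ht ht₁ hc iht ihc =>
    have rootSum_t := Nat.mul_le_mul_left (2 * c.rootCount) t.size_add_one_mul_rootCount_le
    have rootSum_c := mul_add_mul_le_mul_add_mul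
      (show 1 ≤ 2 * t.rootCount by have := t.rootCount_pos; lia) c.size_add_one_mul_rootCount_le
    have count_t := Nat.mul_le_mul_left c.size ht₁.two_mul_count_add_size_lt
    have count_c := Nat.mul_le_mul_left t.size hc.two_mul_count_add_size_lt
    have := t.size_pos
    have := c.size_pos
    have := c.rootCount_pos
    rcases ht₁.eq_single_or_eq_cherry_or_le with rfl | rfl | ht' <;>
      rcases hc.eq_single_or_eq_cherry_or_le with rfl | rfl | hc' <;>
      simp only [size, count, sum, rootSum, rootCount] at * <;>
      first | contradiction | nlinarith

end Branching

lemma Reduced.size_mul_count_le :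
    ∀ {b : GraftTree}, b.Reduced → b.numChildren = 1 → b.size * b.count ≤ 2 * b.sum
  | graft single _, ⟨_, hc, hc₁⟩, _ => (hc.branching hc₁).size_mul_count_graft_single_le

end GraftTree

/-! ### Connected vertex sets -/

section Connected

variable {V W : Type*} {G : SimpleGraph V} {H : SimpleGraph W}

lemma reachable_of_adj_imp (f : V → W)
    (hf : ∀ x y, G.Adj x y → f x = f y ∨ H.Adj (f x) (f y)) {x y : V} (h : G.Reachable x y) :
    H.Reachable (f x) (f y) := by
  obtain ⟨p⟩ := h
  induction p with
  | nil => rfl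
  | cons h _ ih =>
    rcases hf _ _ h with h | h
    · rwa [h]
    · exact h.reachable.trans ih

lemma not_connected_induce_empty : ¬ (G.induce (∅ : Set V)).Connected :=
  fun h => h.nonempty.elim fun x => x.2

lemma connected_induce_image_iff (e : G ↪g H) (s : Set V) :
    (H.induce (e '' s)).Connected ↔ (G.induce s).Connected :=
  (SimpleGraph.Iso.connected_iff
    ⟨Equiv.Set.image e s e.injective, fun {_ _} => e.map_adj_iff⟩).symm

/-- Sending all of `B \ A` to `v` is a contraction of `G.induce (A ∪ B)` onto `G.induce A`. -/
lemma connected_induce_left_of_union {A B : Set V} {v : V} (h : (G.induce (A ∪ B)).Connected)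
    (hv : v ∈ A) (hAB : ∀ x ∈ A, ∀ y ∈ B, G.Adj x y → x = v) : (G.induce A).Connected := by
  classical
  let f : ↥(A ∪ B) → A := fun x => if hx : x.1 ∈ A then ⟨x, hx⟩ else ⟨v, hv⟩
  have hf (x : A) : f ⟨x, .inl x.2⟩ = x := dif_pos x.2
  refine (SimpleGraph.connected_iff _).2 ⟨fun x y => ?_, ⟨⟨v, hv⟩⟩⟩
  rw [← hf x, ← hf y]
  refine reachable_of_adj_imp f (fun a b hab => ?_) (h.preconnected _ _)
  by_cases ha : a.1 ∈ A <;> by_cases hb : b.1 ∈ A <;>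
    simp only [f, ha, hb, dif_pos, dif_neg, not_false_eq_true, true_or]
  · exact Or.inr hab
  · exact Or.inl (Subtype.ext (hAB a ha b (b.2.resolve_left hb) hab))
  · exact Or.inl (Subtype.ext (hAB b hb a (a.2.resolve_left ha) hab.symm).symm)

lemma exists_adj_of_connected_induce_union {A B : Set V} (h : (G.induce (A ∪ B)).Connected)
    (hA : A.Nonempty) (hB : B.Nonempty) (hAB : Disjoint A B) : ∃ x ∈ A, ∃ y ∈ B, G.Adj x y := by
  obtain ⟨x, hx⟩ := hA
  obtain ⟨y, hy⟩ := hB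
  obtain ⟨p⟩ := h.preconnected ⟨x, .inl hx⟩ ⟨y, .inr hy⟩
  obtain ⟨d, -, h₁, h₂⟩ :=
    p.exists_boundary_dart (Subtype.val ⁻¹' A) hx (hAB.notMem_of_mem_right hy)
  exact ⟨d.fst, h₁, d.snd, d.snd.2.resolve_left h₂, d.adj⟩

lemma ncard_neighborSet_iso (φ : G ≃g H) (v : V) :
    (H.neighborSet (φ v)).ncard = (G.neighborSet v).ncard := by
  simpa using (Nat.card_congr (φ.mapNeighborSet v)).symm

/-- The vertex sets inducing connected subgraphs. In a forest these correspond to the subtrees. -/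
noncomputable def connectedSets [Finite V] (G : SimpleGraph V) : Finset (Set V) :=
  (Set.toFinite {s | (G.induce s).Connected}).toFinset

/-- The vertex sets containing `v` and inducing connected subgraphs. -/
noncomputable def connectedSetsAt [Finite V] (G : SimpleGraph V) (v : V) : Finset (Set V) :=
  open Classical in {s ∈ connectedSets G | v ∈ s}

@[simp] lemma mem_connectedSets [Finite V] {s : Set V} :
    s ∈ connectedSets G ↔ (G.induce s).Connected := by
  simp [connectedSets]

@[simp] lemma mem_connectedSetsAt [Finite V] {v : V} {s : Set V} :
    s ∈ connectedSetsAt G v ↔ (G.induce s).Connected ∧ v ∈ s := by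
  simp [connectedSetsAt]

end Connected

/-! ### Joining two rooted graphs by an edge -/

section GraftGraph

variable {V W : Type*} {G : SimpleGraph V} {v : V} {H : SimpleGraph W} {u : W}

/-- The disjoint union of two graphs together with an edge joining `v` to `u`. -/
def graftGraph (G : SimpleGraph V) (v : V) (H : SimpleGraph W) (u : W) : SimpleGraph (V ⊕ W) :=
  (G ⊕g H) ⊔ SimpleGraph.edge (Sum.inl v) (Sum.inr u)

@[simp] lemma graftGraph_adj_inl_inl {a b : V} :
    (graftGraph G v H u).Adj (Sum.inl a) (Sum.inl b) ↔ G.Adj a b := by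
  simp [graftGraph, SimpleGraph.edge_adj]

@[simp] lemma graftGraph_adj_inr_inr {a b : W} :
    (graftGraph G v H u).Adj (Sum.inr a) (Sum.inr b) ↔ H.Adj a b := by
  simp [graftGraph, SimpleGraph.edge_adj]

@[simp] lemma graftGraph_adj_inl_inr {a : V} {b : W} :
    (graftGraph G v H u).Adj (Sum.inl a) (Sum.inr b) ↔ a = v ∧ b = u := by
  simp [graftGraph, SimpleGraph.edge_adj]

@[simp] lemma graftGraph_adj_inr_inl {a : V} {b : W} :
    (graftGraph G v H u).Adj (Sum.inr b) (Sum.inl a) ↔ a = v ∧ b = u := by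
  rw [SimpleGraph.adj_comm, graftGraph_adj_inl_inr]

/-- The left summand as an induced subgraph of `graftGraph G v H u`. -/
def graftGraphInl (G : SimpleGraph V) (v : V) (H : SimpleGraph W) (u : W) :
    G ↪g graftGraph G v H u :=
  ⟨.inl, graftGraph_adj_inl_inl⟩

/-- The right summand as an induced subgraph of `graftGraph G v H u`. -/
def graftGraphInr (G : SimpleGraph V) (v : V) (H : SimpleGraph W) (u : W) :
    H ↪g graftGraph G v H u :=
  ⟨.inr, graftGraph_adj_inr_inr⟩

lemma isAcyclic_sum (hG : G.IsAcyclic) (hH : H.IsAcyclic) : (G ⊕g H).IsAcyclic := by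
  rw [SimpleGraph.isAcyclic_iff_forall_adj_isBridge] at *
  rintro (a | a) (b | b) hab h
  · refine hG (by simpa using hab) (reachable_of_adj_imp (Sum.elim id fun _ => a) ?_ h)
    rintro (x | x) (y | y) <;> simp; tauto
  · simp at hab
  · simp at hab
  · refine hH (by simpa using hab) (reachable_of_adj_imp (Sum.elim (fun _ => a) id) ?_ h)
    rintro (x | x) (y | y) <;> simp; tauto

lemma isTree_graftGraph (hG : G.IsTree) (hH : H.IsTree) : (graftGraph G v H u).IsTree :=
  ⟨hG.1.sum_sup_edge hH.1, (isAcyclic_sum hG.2 hH.2).sup_edge_of_not_reachable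
    (SimpleGraph.not_reachable_sum_inl_inr v u)⟩

lemma connected_induce_image_inl {s : Set V} :
    ((graftGraph G v H u).induce (Sum.inl '' s)).Connected ↔ (G.induce s).Connected :=
  connected_induce_image_iff (graftGraphInl G v H u) s

lemma connected_induce_image_inr {t : Set W} :
    ((graftGraph G v H u).induce (Sum.inr '' t)).Connected ↔ (H.induce t).Connected :=
  connected_induce_image_iff (graftGraphInr G v H u) t

lemma connected_induce_graftGraph_of_nonempty {s : Set V} {t : Set W} (hs : s.Nonempty)
    (ht : t.Nonempty) :
    ((graftGraph G v H u).induce (Sum.inl '' s ∪ Sum.inr '' t)).Connected ↔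
      ((G.induce s).Connected ∧ v ∈ s) ∧ ((H.induce t).Connected ∧ u ∈ t) := by
  constructor
  · intro h
    obtain ⟨hv, hu⟩ : v ∈ s ∧ u ∈ t := by
      obtain ⟨_, ⟨x, hx, rfl⟩, _, ⟨y, hy, rfl⟩, hxy⟩ := exists_adj_of_connected_induce_union h
        (hs.image _) (ht.image _) Set.disjoint_image_inl_image_inr
      obtain ⟨rfl, rfl⟩ := graftGraph_adj_inl_inr.1 hxy
      exact ⟨hx, hy⟩
    have hG := connected_induce_left_of_union h (Set.mem_image_of_mem _ hv) (by simp +contextual)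
    rw [Set.union_comm] at h
    have hH := connected_induce_left_of_union h (Set.mem_image_of_mem _ hu) (by simp +contextual)
    exact ⟨⟨connected_induce_image_inl.1 hG, hv⟩, connected_induce_image_inr.1 hH, hu⟩
  · rintro ⟨⟨hs, hv⟩, ht, hu⟩
    exact SimpleGraph.connected_induce_union (connected_induce_image_inl.2 hs).preconnected
      (connected_induce_image_inr.2 ht).preconnected (Set.mem_image_of_mem _ hv)
      (Set.mem_image_of_mem _ hu) (by simp)

lemma connected_induce_graftGraph_iff {p : Set V × Set W} :
    ((graftGraph G v H u).induce (Set.sumEquiv.symm p)).Connected ↔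
      ((G.induce p.1).Connected ∧ p.2 = ∅) ∨ (p.1 = ∅ ∧ (H.induce p.2).Connected) ∨
        (((G.induce p.1).Connected ∧ v ∈ p.1) ∧ ((H.induce p.2).Connected ∧ u ∈ p.2)) := by
  obtain ⟨s, t⟩ := p
  rw [Set.sumEquiv_symm_apply]
  rcases s.eq_empty_or_nonempty with rfl | hs
  · rw [Set.image_empty, Set.empty_union, connected_induce_image_inr]
    simp [not_connected_induce_empty]
  rcases t.eq_empty_or_nonempty with rfl | ht
  · rw [Set.image_empty, Set.union_empty, connected_induce_image_inl]
    simp [not_connected_induce_empty]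
  · simp [connected_induce_graftGraph_of_nonempty hs ht, hs.ne_empty, ht.ne_empty]

open Classical in
lemma connectedSets_graftGraph [Finite V] [Finite W] :
    connectedSets (graftGraph G v H u) = (connectedSets G ×ˢ {∅} ∪ {∅} ×ˢ connectedSets H ∪
      connectedSetsAt G v ×ˢ connectedSetsAt H u).map Set.sumEquiv.symm.toEmbedding := by
  ext S
  obtain ⟨p, rfl⟩ := Set.sumEquiv.symm.surjective S
  rw [mem_connectedSets, connected_induce_graftGraph_iff]
  refine Iff.trans ?_ (Finset.mem_map' Set.sumEquiv.symm.toEmbedding).symm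
  obtain ⟨s, t⟩ := p
  simp only [Finset.mem_union, Finset.mem_product, Finset.mem_singleton, mem_connectedSets,
    mem_connectedSetsAt, or_assoc]

lemma sum_connectedSets_graftGraph [Finite V] [Finite W] {M : Type*} [AddCommMonoid M]
    (F : Set (V ⊕ W) → M) :
    ∑ S ∈ connectedSets (graftGraph G v H u), F S =
      ∑ s ∈ connectedSets G, F (Sum.inl '' s) + ∑ t ∈ connectedSets H, F (Sum.inr '' t) +
      ∑ s ∈ connectedSetsAt G v, ∑ t ∈ connectedSetsAt H u, F (Sum.inl '' s ∪ Sum.inr '' t) := by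
  classical
  rw [connectedSets_graftGraph, Finset.sum_map, Finset.sum_union, Finset.sum_union]
  · simp [Finset.sum_product]
  · exact Finset.disjoint_product.2 (.inl (by simp [not_connected_induce_empty]))
  · exact Finset.disjoint_union_left.2 ⟨Finset.disjoint_product.2 (.inr (by simp)),
      Finset.disjoint_product.2 (.inl (by simp))⟩

lemma sum_connectedSetsAt_graftGraph [Finite V] [Finite W] {M : Type*} [AddCommMonoid M]
    (F : Set (V ⊕ W) → M) :
    ∑ S ∈ connectedSetsAt (graftGraph G v H u) (.inl v), F S =
      ∑ s ∈ connectedSetsAt G v, F (Sum.inl '' s) +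
      ∑ s ∈ connectedSetsAt G v, ∑ t ∈ connectedSetsAt H u, F (Sum.inl '' s ∪ Sum.inr '' t) := by
  classical
  rw [connectedSetsAt, Finset.sum_filter, sum_connectedSets_graftGraph, connectedSetsAt,
    Finset.sum_filter, Finset.sum_filter, Finset.sum_filter]
  simp only [Set.mem_image, Set.mem_union, Sum.inl.injEq, reduceCtorEq, and_false, exists_false,
    exists_eq_right, or_false, if_false, Finset.sum_const_zero, add_zero, Finset.sum_ite_irrel]
  congr 1
  refine Finset.sum_congr rfl fun s _ => ?_
  split_ifs <;> simp

lemma ncard_image_inl_union_image_inr [Finite V] [Finite W] (s : Set V) (t : Set W) :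
    (Sum.inl '' s ∪ Sum.inr '' t).ncard = s.ncard + t.ncard := by
  rw [Set.ncard_union_eq Set.disjoint_image_inl_image_inr,
    Set.ncard_image_of_injective _ Sum.inl_injective,
    Set.ncard_image_of_injective _ Sum.inr_injective]

open Classical in
lemma ncard_neighborSet_graftGraph_inl [Finite V] [Finite W] (a : V) :
    ((graftGraph G v H u).neighborSet (.inl a)).ncard =
      (G.neighborSet a).ncard + if a = v then 1 else 0 := by
  have : (graftGraph G v H u).neighborSet (.inl a) =
      Sum.inl '' G.neighborSet a ∪ Sum.inr '' {b | a = v ∧ b = u} := by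
    ext (x | x) <;> simp
  rw [this, ncard_image_inl_union_image_inr]
  split_ifs with h <;> simp [h]

open Classical in
lemma ncard_neighborSet_graftGraph_inr [Finite V] [Finite W] (b : W) :
    ((graftGraph G v H u).neighborSet (.inr b)).ncard =
      (H.neighborSet b).ncard + if b = u then 1 else 0 := by
  have : (graftGraph G v H u).neighborSet (.inr b) =
      Sum.inl '' {a | a = v ∧ b = u} ∪ Sum.inr '' H.neighborSet b := by
    ext (x | x) <;> simp
  rw [this, ncard_image_inl_union_image_inr, add_comm]
  split_ifs with h <;> simp [h]

lemma forall_ncard_neighborSet_graftGraph_ne_two_iff [Finite V] [Finite W] :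
    (∀ x ≠ .inl v, ((graftGraph G v H u).neighborSet x).ncard ≠ 2) ↔
      (∀ a ≠ v, (G.neighborSet a).ncard ≠ 2) ∧ (∀ b ≠ u, (H.neighborSet b).ncard ≠ 2) ∧
        (H.neighborSet u).ncard ≠ 1 := by
  simp only [Sum.forall, ncard_neighborSet_graftGraph_inl, ncard_neighborSet_graftGraph_inr,
    ne_eq, Sum.inl.injEq, reduceCtorEq, not_false_eq_true, forall_const]
  refine and_congr (forall_congr' fun a => imp_congr_right fun ha => by simp [ha])
    ⟨fun h => ⟨fun b hb => by simpa [hb] using h b, by simpa using h u⟩, fun h b => ?_⟩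
  rcases eq_or_ne b u with rfl | hb
  · simpa using h.2
  · simpa [hb] using h.1 b hb

end GraftGraph

/-! ### Realising rooted trees as graphs -/

namespace GraftTree

/-- The vertices of the graph `b.graph` realising `b`. -/
def Vertex : GraftTree → Type
  | single => Unit
  | graft t c => t.Vertex ⊕ c.Vertex

/-- The root of `b` as a vertex of `b.graph`. -/
def root : ∀ b : GraftTree, b.Vertex
  | single => ()
  | graft t _ => Sum.inl t.root

/-- The rooted tree `b` as a graph. -/
def graph : ∀ b : GraftTree, SimpleGraph b.Vertex
  | single => ⊥
  | graft t c => graftGraph t.graph t.root c.graph c.root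

instance : ∀ b : GraftTree, Finite b.Vertex
  | single => inferInstanceAs (Finite Unit)
  | graft t c =>
    have := instFiniteVertex t
    have := instFiniteVertex c
    inferInstanceAs (Finite (t.Vertex ⊕ c.Vertex))

instance : Unique single.Vertex := inferInstanceAs (Unique Unit)

lemma isTree_graph : ∀ b : GraftTree, b.graph.IsTree
  | single => .of_subsingleton
  | graft t c => isTree_graftGraph t.isTree_graph c.isTree_graph

lemma card_vertex : ∀ b : GraftTree, Nat.card b.Vertex = b.size
  | single => Nat.card_unique
  | graft t c => by rw [size, ← t.card_vertex, ← c.card_vertex]; exact Nat.card_sum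

lemma connectedSets_single : connectedSets single.graph = {Set.univ} := by
  ext s
  rw [mem_connectedSets, Finset.mem_singleton]
  refine ⟨fun h => Subsingleton.eq_univ_of_nonempty (Set.nonempty_coe_sort.1 h.nonempty), ?_⟩
  rintro rfl
  exact SimpleGraph.induceUnivIso _ |>.connected_iff.2 single.isTree_graph.connected

lemma connectedSetsAt_single : connectedSetsAt single.graph single.root = {Set.univ} := by
  ext s
  rw [mem_connectedSetsAt, ← mem_connectedSets, connectedSets_single]
  simp +contextual

lemma card_connectedSetsAt (b : GraftTree) :
    (connectedSetsAt b.graph b.root).card = b.rootCount := by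
  induction b with
  | single => simp [connectedSetsAt_single]
  | graft t c ht hc =>
    rw [Finset.card_eq_sum_ones]
    refine (sum_connectedSetsAt_graftGraph fun _ => 1).trans ?_
    simp only [Finset.sum_const, smul_eq_mul, mul_one, ht, hc, rootCount, mul_add]

lemma sum_connectedSetsAt (b : GraftTree) :
    ∑ s ∈ connectedSetsAt b.graph b.root, s.ncard = b.rootSum := by
  induction b with
  | single => simp [connectedSetsAt_single]
  | graft t c ht hc =>
    refine (sum_connectedSetsAt_graftGraph
      fun S : Set (t.Vertex ⊕ c.Vertex) => S.ncard).trans ?_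
    simp only [ncard_image_inl_union_image_inr, Finset.sum_add_distrib, Finset.sum_const,
      smul_eq_mul, ← Finset.mul_sum, card_connectedSetsAt, ht, hc, rootSum,
      Set.ncard_image_of_injective _ Sum.inl_injective]
    ring

lemma card_connectedSets (b : GraftTree) : (connectedSets b.graph).card = b.count := by
  induction b with
  | single => simp [connectedSets_single]
  | graft t c ht hc =>
    rw [Finset.card_eq_sum_ones]
    refine (sum_connectedSets_graftGraph fun _ => 1).trans ?_
    simp only [Finset.sum_const, smul_eq_mul, mul_one, ht, hc, card_connectedSetsAt, count]

lemma sum_connectedSets (b : GraftTree) : ∑ s ∈ connectedSets b.graph, s.ncard = b.sum := by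
  induction b with
  | single => simp [connectedSets_single]
  | graft t c ht hc =>
    refine (sum_connectedSets_graftGraph
      fun S : Set (t.Vertex ⊕ c.Vertex) => S.ncard).trans ?_
    simp only [ncard_image_inl_union_image_inr, Finset.sum_add_distrib, Finset.sum_const,
      smul_eq_mul, ← Finset.mul_sum, card_connectedSetsAt, sum_connectedSetsAt, ht, hc, sum,
      Set.ncard_image_of_injective _ Sum.inl_injective,
      Set.ncard_image_of_injective _ Sum.inr_injective]
    ring

lemma ncard_neighborSet_root (b : GraftTree) :
    (b.graph.neighborSet b.root).ncard = b.numChildren := by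
  induction b with
  | single => simp [graph]
  | graft t c ht _ =>
    exact (ncard_neighborSet_graftGraph_inl _).trans (by rw [if_pos rfl, ht, numChildren])

lemma reduced_iff (b : GraftTree) :
    b.Reduced ↔ ∀ x ≠ b.root, (b.graph.neighborSet x).ncard ≠ 2 := by
  induction b with
  | single => simp [Subsingleton.elim _ single.root]
  | graft t c ht hc =>
    rw [Reduced, ht, hc, ← ncard_neighborSet_root]
    exact forall_ncard_neighborSet_graftGraph_ne_two_iff.symm

lemma isSeriesReduced_graph_iff (b : GraftTree) :
    IsSeriesReduced b.graph ↔ b.Reduced ∧ b.numChildren ≠ 2 := by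
  rw [reduced_iff, ← ncard_neighborSet_root]
  refine ⟨fun h => ⟨fun x _ => h x, h _⟩, fun h x => ?_⟩
  rcases eq_or_ne x b.root with rfl | hx
  exacts [h.2, h.1 x hx]

end GraftTree

/-! ### Cutting a tree at an edge -/

section Splitting

variable {V W V' W' : Type*} {G : SimpleGraph V} {H : SimpleGraph W} {G' : SimpleGraph V'}
  {H' : SimpleGraph W'}

/-- Isomorphic rooted graphs give isomorphic results when joined by an edge. -/
def graftGraphCongr {v : V} {v' : V'} {u : W} {u' : W'} (φ : G ≃g G') (hφ : φ v = v')
    (ψ : H ≃g H') (hψ : ψ u = u') : graftGraph G v H u ≃g graftGraph G' v' H' u' where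
  toEquiv := φ.toEquiv.sumCongr ψ.toEquiv
  map_rel_iff' := by
    subst hφ hψ
    rintro (a | a) (b | b) <;> simp [φ.map_adj_iff, ψ.map_adj_iff]

variable {v u : V}

open Classical in
/-- A graph with a single edge between `A` and its complement arises by joining the two sides. -/
noncomputable def graftGraphInduceIso {A : Set V} (hv : v ∈ A) (hu : u ∈ Aᶜ)
    (h : ∀ x ∈ A, ∀ y ∈ Aᶜ, G.Adj x y ↔ x = v ∧ y = u) :
    graftGraph (G.induce A) ⟨v, hv⟩ (G.induce Aᶜ) ⟨u, hu⟩ ≃g G where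
  toEquiv := Equiv.Set.sumCompl A
  map_rel_iff' := by
    rintro (⟨x, hx⟩ | ⟨x, hx⟩) (⟨y, hy⟩ | ⟨y, hy⟩)
    · simp
    · simpa using h x hx y hy
    · simpa [G.adj_comm x y] using h y hy x hx
    · simp

lemma connected_induce_of_adj_imp {A : Set V} (hG : G.Connected) (hv : v ∈ A)
    (h : ∀ x ∈ A, ∀ y ∈ Aᶜ, G.Adj x y → x = v) : (G.induce A).Connected := by
  refine connected_induce_left_of_union (B := Aᶜ) ?_ hv h
  rw [Set.union_compl_self]
  exact (SimpleGraph.induceUnivIso G).connected_iff.2 hG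

lemma exists_cut_of_isAcyclic (hG : G.IsAcyclic) (hvu : G.Adj v u) :
    ∃ A : Set V, v ∈ A ∧ u ∈ Aᶜ ∧ ∀ x ∈ A, ∀ y ∈ Aᶜ, G.Adj x y ↔ x = v ∧ y = u := by
  refine ⟨{w | (G.deleteEdges {s(v, u)}).Reachable v w}, .rfl,
    SimpleGraph.isAcyclic_iff_forall_adj_isBridge.1 hG hvu,
    fun x hx y hy => ⟨fun hxy => ?_, by rintro ⟨rfl, rfl⟩; exact hvu⟩⟩
  by_contra hne
  refine hy (hx.trans (SimpleGraph.Adj.reachable ?_))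
  rw [SimpleGraph.deleteEdges_adj, Set.mem_singleton_iff, Sym2.eq_iff]
  refine ⟨hxy, ?_⟩
  rintro (h | ⟨rfl, rfl⟩)
  exacts [hne h, hy .rfl]

end Splitting

lemma GraftTree.exists_iso_graph {V : Type*} [Finite V] {G : SimpleGraph V} (hG : G.IsTree)
    (v : V) : ∃ (b : GraftTree) (φ : b.graph ≃g G), φ b.root = v := by
  induction hn : Nat.card V using Nat.strong_induction_on generalizing V with
  | _ n ih =>
  subst hn
  rcases subsingleton_or_nontrivial V with hV | hV
  · have := uniqueOfSubsingleton v
    exact ⟨single, ⟨Equiv.ofUnique _ _, by simp [Subsingleton.elim _ v, graph]⟩,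
      Subsingleton.elim _ _⟩
  obtain ⟨u, hvu⟩ := hG.connected.preconnected.exists_adj_of_nontrivial v
  obtain ⟨A, hv, hu, h⟩ := exists_cut_of_isAcyclic hG.isAcyclic hvu
  have isTree_A : (G.induce A).IsTree :=
    ⟨connected_induce_of_adj_imp hG.connected hv fun x hx y hy hxy => ((h x hx y hy).1 hxy).1,
      hG.isAcyclic.induce _⟩
  have isTree_compl : (G.induce Aᶜ).IsTree :=
    ⟨connected_induce_of_adj_imp hG.connected hu fun y hy x hx hxy =>
      ((h x (not_not.1 hx) y hy).1 hxy.symm).2, hG.isAcyclic.induce _⟩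
  have card_A : Nat.card A < Nat.card V := Finite.card_subtype_lt hu
  have card_compl : Nat.card ↥Aᶜ < Nat.card V := Finite.card_subtype_lt (not_not.2 hv)
  obtain ⟨t, φ, hφ⟩ := ih _ card_A isTree_A ⟨v, hv⟩ rfl
  obtain ⟨c, ψ, hψ⟩ := ih _ card_compl isTree_compl ⟨u, hu⟩ rfl
  exact ⟨graft t c, (graftGraphCongr φ hφ ψ hψ).trans (graftGraphInduceIso hv hu h),
    congrArg Subtype.val hφ⟩

/-! ### Subtree densities of rooted trees -/

section Density

variable {V W : Type*} {T : SimpleGraph V} {T' : SimpleGraph W}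

lemma isInduced_of_isTree (hT : T.IsAcyclic) {S : T.Subgraph} (hS : S.coe.IsTree) :
    S.IsInduced := by
  intro x hx y hy hxy
  by_contra h
  refine SimpleGraph.isAcyclic_iff_forall_adj_isBridge.1 hT hxy
    (reachable_of_adj_imp (G := S.coe) Subtype.val (fun a b hab => .inr ?_)
      (hS.connected.preconnected ⟨x, hx⟩ ⟨y, hy⟩))
  rw [SimpleGraph.Subgraph.coe_adj] at hab
  rw [SimpleGraph.deleteEdges_adj, Set.mem_singleton_iff, Sym2.eq_iff]
  refine ⟨hab.adj_sub, ?_⟩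
  rintro (⟨h₁, h₂⟩ | ⟨h₁, h₂⟩) <;> rw [h₁, h₂] at hab
  exacts [h hab, h hab.symm]

lemma isSeriesReduced_iso (φ : T ≃g T') : IsSeriesReduced T' ↔ IsSeriesReduced T := by
  rw [IsSeriesReduced, φ.surjective.forall]
  exact forall_congr' fun v => by rw [ncard_neighborSet_iso]

variable [Finite V] [Finite W]

lemma sum_subtrees (hT : T.IsAcyclic) {M : Type*} [AddCommMonoid M] (F : Set V → M) :
    ∑ S ∈ subtrees T, F S.verts = ∑ s ∈ connectedSets T, F s := by
  have mem_subtrees {S : T.Subgraph} : S ∈ subtrees T ↔ S.coe.IsTree := by simp [subtrees]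
  refine Finset.sum_bij' (fun S _ => S.verts) (fun s _ => (⊤ : T.Subgraph).induce s) ?_ ?_ ?_ ?_ ?_
  · intro S hS
    rw [mem_subtrees] at hS
    have connected := hS.connected
    rw [← (isInduced_of_isTree hT hS).induce_top_verts] at connected
    rwa [mem_connectedSets, SimpleGraph.induce_eq_coe_induce_top]
  · intro s hs
    rw [mem_connectedSets, SimpleGraph.induce_eq_coe_induce_top] at hs
    exact mem_subtrees.2 ⟨hs, hT.subgraph _⟩
  · intro S hS
    exact (isInduced_of_isTree hT (mem_subtrees.1 hS)).induce_top_verts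
  · exact fun _ _ => rfl
  · exact fun _ _ => rfl

lemma density_eq_div (hT : T.IsAcyclic) :
    density T = (∑ s ∈ connectedSets T, s.ncard : ℕ) /
      ((Nat.card V : ℝ) * (connectedSets T).card) := by
  have card : numSubtrees T = (connectedSets T).card := by
    rw [numSubtrees, Finset.card_eq_sum_ones, sum_subtrees hT fun _ => 1, Finset.card_eq_sum_ones]
  rw [density, meanSubtreeOrder, sum_subtrees hT fun s => (s.ncard : ℝ), card, div_div, mul_comm,
    Nat.cast_sum]

lemma sum_connectedSets_iso (φ : T ≃g T') {M : Type*} [AddCommMonoid M] (F : ℕ → M) :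
    ∑ s ∈ connectedSets T, F s.ncard = ∑ s ∈ connectedSets T', F s.ncard := by
  refine Finset.sum_equiv (Equiv.Set.congr φ.toEquiv) (fun s => ?_) fun s _ => ?_
  · rw [mem_connectedSets, mem_connectedSets]
    exact (connected_induce_image_iff φ.toEmbedding s).symm
  · exact congrArg F (Set.ncard_image_of_injective s φ.injective).symm

lemma density_iso (hT : T.IsAcyclic) (φ : T ≃g T') : density T' = density T := by
  rw [density_eq_div hT, density_eq_div (φ.isAcyclic_iff.1 hT), Nat.card_congr φ.toEquiv,
    Finset.card_eq_sum_ones, Finset.card_eq_sum_ones, sum_connectedSets_iso φ fun n => n,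
    sum_connectedSets_iso φ fun _ => 1]

/-- The subtree densities of finite trees. -/
def treeDensities : Set ℝ :=
  {d | ∃ (n : ℕ) (T : SimpleGraph (Fin n)), T.IsTree ∧ density T = d}

/-- The subtree densities of finite series-reduced trees with at least two vertices. -/
def seriesReducedTreeDensities : Set ℝ :=
  {d | ∃ (n : ℕ) (T : SimpleGraph (Fin n)),
    T.IsTree ∧ IsSeriesReduced T ∧ 2 ≤ n ∧ density T = d}

lemma density_mem_treeDensities (hT : T.IsTree) : density T ∈ treeDensities := by
  let φ := SimpleGraph.Iso.map (Finite.equivFin V) T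
  exact ⟨_, _, φ.isTree_iff.1 hT, density_iso hT.isAcyclic φ⟩

lemma density_mem_seriesReducedTreeDensities (hT : T.IsTree) (hr : IsSeriesReduced T)
    (hV : 2 ≤ Nat.card V) : density T ∈ seriesReducedTreeDensities := by
  let φ := SimpleGraph.Iso.map (Finite.equivFin V) T
  exact ⟨_, _, φ.isTree_iff.1 hT, (isSeriesReduced_iso φ).2 hr, hV, density_iso hT.isAcyclic φ⟩

lemma GraftTree.density_graph (b : GraftTree) :
    density b.graph = b.sum / ((b.size : ℝ) * b.count) := by
  rw [density_eq_div b.isTree_graph.isAcyclic, b.sum_connectedSets, b.card_vertex,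
    b.card_connectedSets]

lemma GraftTree.size_mul_count_pos (b : GraftTree) : 0 < (b.size : ℝ) * b.count :=
  mul_pos (Nat.cast_pos.2 b.size_pos) (Nat.cast_pos.2 b.count_pos)

theorem density_mem_Icc (hT : T.IsTree) : density T ∈ Set.Icc (1 / 3 : ℝ) 1 := by
  obtain ⟨v⟩ := hT.connected.nonempty
  obtain ⟨b, φ, -⟩ := GraftTree.exists_iso_graph hT v
  have lower : ((b.size + 2) * b.count : ℝ) ≤ 3 * b.sum := mod_cast b.size_add_two_mul_count_le
  have upper : (2 * b.sum + b.leafCount * b.count : ℝ) ≤ 2 * (b.size * b.count) :=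
    mod_cast b.two_mul_sum_add_le
  rw [density_iso b.isTree_graph.isAcyclic φ, b.density_graph, Set.mem_Icc,
    le_div_iff₀ b.size_mul_count_pos, div_le_iff₀ b.size_mul_count_pos]
  have := b.count.cast_nonneg (α := ℝ)
  have := mul_nonneg (b.leafCount.cast_nonneg (α := ℝ)) this
  constructor <;> linarith

theorem density_mem_Icc_of_isSeriesReduced (hT : T.IsTree) (hr : IsSeriesReduced T)
    (hV : 2 ≤ Nat.card V) : density T ∈ Set.Icc (1 / 2 : ℝ) (3 / 4) := by
  classical
  have := Fintype.ofFinite V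
  have : Nontrivial V := Finite.one_lt_card_iff_nontrivial.1 hV
  obtain ⟨v, hv⟩ := hT.exists_vert_degree_one_of_nontrivial
  obtain ⟨b, φ, rfl⟩ := GraftTree.exists_iso_graph hT v
  have hb : b.numChildren = 1 := by
    rw [← b.ncard_neighborSet_root, ← ncard_neighborSet_iso φ, ← hv, Set.ncard_eq_toFinset_card',
      SimpleGraph.degree, SimpleGraph.neighborFinset]
  have reduced := (b.isSeriesReduced_graph_iff.1 ((isSeriesReduced_iso φ).1 hr)).1
  have lower : (b.size * b.count : ℝ) ≤ 2 * b.sum := mod_cast reduced.size_mul_count_le hb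
  have upper : (4 * b.sum : ℝ) ≤ 3 * (b.size * b.count) := mod_cast reduced.four_mul_sum_le hb.ge
  rw [density_iso b.isTree_graph.isAcyclic φ, b.density_graph, Set.mem_Icc,
    le_div_iff₀ b.size_mul_count_pos, div_le_iff₀ b.size_mul_count_pos]
  constructor <;> linarith

end Density

namespace GraftTree

/-! ### Density of the values in `[1 / 3, 1]` -/

/-- The tree `t` with `k` leaves attached to its root. -/
def addLeaves (t : GraftTree) : ℕ → GraftTree
  | 0 => t
  | k + 1 => graft (t.addLeaves k) single

/-- The tree `t` with its root attached to the end of a path with `j` vertices. The other end of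
the path is the new root. -/
def addPath (t : GraftTree) : ℕ → GraftTree
  | 0 => t
  | j + 1 => graft single (t.addPath j)

section AddLeaves

variable (t : GraftTree) (k : ℕ)

lemma size_addLeaves : (t.addLeaves k).size = t.size + k := by
  induction k with
  | zero => rfl
  | succ k ih => rw [addLeaves, size, ih, size, add_assoc]

lemma numChildren_addLeaves : (t.addLeaves k).numChildren = t.numChildren + k := by
  induction k with
  | zero => rfl
  | succ k ih => rw [addLeaves, numChildren, ih, add_assoc]

lemma rootCount_addLeaves : (t.addLeaves k).rootCount = 2 ^ k * t.rootCount := by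
  induction k with
  | zero => simp [addLeaves]
  | succ k ih => rw [addLeaves, rootCount, ih, rootCount]; ring

lemma rootSum_addLeaves :
    ((t.addLeaves k).rootSum : ℝ) = 2 ^ k * (t.rootSum + k / 2 * t.rootCount) := by
  induction k with
  | zero => simp [addLeaves]
  | succ k ih =>
    simp only [addLeaves, rootSum, rootCount, rootCount_addLeaves]
    push_cast [ih]
    ring

lemma count_addLeaves :
    ((t.addLeaves k).count : ℝ) = t.count + (2 ^ k - 1) * t.rootCount + k := by
  induction k with
  | zero => simp [addLeaves]
  | succ k ih =>
    simp only [addLeaves, count, rootCount, rootCount_addLeaves]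
    push_cast [ih]
    ring

lemma sum_addLeaves : ((t.addLeaves k).sum : ℝ) =
    t.sum + (2 ^ k * (t.rootSum + k / 2 * t.rootCount) - t.rootSum) + k := by
  induction k with
  | zero => simp [addLeaves]
  | succ k ih =>
    simp only [addLeaves, sum, rootSum, rootCount, rootCount_addLeaves]
    push_cast [ih, rootSum_addLeaves]
    ring

variable {t} in
lemma Reduced.addLeaves (h : t.Reduced) : (t.addLeaves k).Reduced := by
  induction k with
  | zero => exact h
  | succ k ih => exact ⟨ih, trivial, by simp⟩

end AddLeaves

section AddPath

variable (t : GraftTree) (j : ℕ)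

lemma size_addPath : (t.addPath j).size = t.size + j := by
  induction j with
  | zero => rfl
  | succ j ih => rw [addPath, size, ih, size]; ring

lemma rootCount_addPath : (t.addPath j).rootCount = t.rootCount + j := by
  induction j with
  | zero => rfl
  | succ j ih => rw [addPath, rootCount, ih, rootCount]; ring

lemma rootSum_addPath :
    ((t.addPath j).rootSum : ℝ) = t.rootSum + j * t.rootCount + j * (j + 1) / 2 := by
  induction j with
  | zero => simp [addPath]
  | succ j ih =>
    simp only [addPath, rootSum, rootCount, rootCount_addPath]
    push_cast [ih]
    ring

lemma count_addPath :
    ((t.addPath j).count : ℝ) = t.count + j * t.rootCount + j * (j + 1) / 2 := by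
  induction j with
  | zero => simp [addPath]
  | succ j ih =>
    simp only [addPath, count, rootCount, rootCount_addPath]
    push_cast [ih]
    ring

lemma sum_addPath : ((t.addPath j).sum : ℝ) =
    t.sum + j * t.rootSum + j * (j + 1) / 2 * t.rootCount + j * (j + 1) * (j + 2) / 6 := by
  induction j with
  | zero => simp [addPath]
  | succ j ih =>
    simp only [addPath, sum, rootSum, rootCount, rootCount_addPath]
    push_cast [ih, rootSum_addPath]
    ring

end AddPath

/-- A path on `j` vertices between the centers of two stars with `k` leaves each. -/
def baton (k j : ℕ) : GraftTree := ((single.addLeaves k).addPath j).addLeaves k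

section Baton

variable (k j : ℕ)

lemma size_baton : (baton k j).size = j + 2 * k + 1 := by
  simp only [baton, size_addLeaves, size_addPath, size]
  ring

lemma count_baton :
    ((baton k j).count : ℝ) = (2 ^ k) ^ 2 + 2 * 2 ^ k * j + (j ^ 2 - j) / 2 + 2 * k := by
  simp only [baton, count_addLeaves, count_addPath, rootCount_addPath, rootCount_addLeaves, count,
    rootCount]
  push_cast
  ring

lemma sum_baton : ((baton k j).sum : ℝ) =
    ((2 ^ k) ^ 2 + 2 ^ k * j) * (j + k + 1) + (j ^ 3 - j) / 6 + 2 * k := by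
  simp only [baton, sum_addLeaves, sum_addPath, rootSum_addPath, rootSum_addLeaves,
    rootCount_addPath, rootCount_addLeaves, sum, rootSum, rootCount]
  push_cast
  ring

end Baton

lemma tendsto_density_baton {c : ℝ} (hc : 0 < c) {j : ℕ → ℕ}
    (hj : Tendsto (fun k => (2 : ℝ) ^ k / j k) atTop (𝓝 c)) :
    Tendsto (fun k => density (baton k (j k)).graph) atTop
      (𝓝 ((c ^ 2 + c + 1 / 6) / (c ^ 2 + 2 * c + 1 / 2))) := by
  have tendsto_nat_div : Tendsto (fun k : ℕ => (k : ℝ) / j k) atTop (𝓝 0) := by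
    simpa [div_mul_div_cancel₀] using
      (tendsto_pow_const_div_const_pow_of_one_lt 1 one_lt_two).mul hj
  have tendsto_one_div : Tendsto (fun k : ℕ => 1 / (j k : ℝ)) atTop (𝓝 0) := by
    simpa [div_eq_mul_inv] using
      (tendsto_pow_const_div_const_pow_of_one_lt 0 one_lt_two).mul hj
  let D : ℝ × ℝ × ℝ → ℝ := fun ⟨u, v, w⟩ =>
    ((u ^ 2 + u) * (1 + v + w) + (1 - w ^ 2) / 6 + 2 * v * w ^ 2) /
      ((1 + 2 * v + w) * (u ^ 2 + 2 * u + (1 - w) / 2 + 2 * v * w))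
  have continuousAt_D : ContinuousAt D (c, 0, 0) :=
    .div (by fun_prop) (by fun_prop) (by norm_num; positivity)
  have D_eq : D (c, 0, 0) = (c ^ 2 + c + 1 / 6) / (c ^ 2 + 2 * c + 1 / 2) := by simp [D]
  rw [← D_eq]
  refine (continuousAt_D.tendsto.comp
    (hj.prodMk_nhds (tendsto_nat_div.prodMk_nhds tendsto_one_div))).congr' ?_
  filter_upwards [hj.eventually_ne hc.ne'] with k hk
  have hjk : (j k : ℝ) ≠ 0 := fun h => hk (by rw [h, div_zero])
  simp only [D, Function.comp_apply]
  rw [density_graph, size_baton, count_baton, sum_baton,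
    ← mul_div_mul_left _ _ (pow_ne_zero 3 hjk)]
  push_cast
  congr 1 <;> field_simp

lemma div_mem_closure_treeDensities {c : ℝ} (hc : 0 < c) :
    (c ^ 2 + c + 1 / 6) / (c ^ 2 + 2 * c + 1 / 2) ∈ closure treeDensities := by
  refine mem_closure_of_tendsto (tendsto_density_baton hc (j := fun k => ⌊c⁻¹ * 2 ^ k⌋₊) ?_)
    (.of_forall fun _ => density_mem_treeDensities (isTree_graph _))
  simpa using ((tendsto_nat_floor_mul_div_atTop (inv_nonneg.2 hc.le)).comp
    (tendsto_pow_atTop_atTop_of_one_lt one_lt_two)).inv₀ (inv_ne_zero hc.ne')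

lemma exists_pos_div_eq {x : ℝ} (hx : x ∈ Set.Ioo (1 / 3 : ℝ) 1) :
    ∃ c > 0, (c ^ 2 + c + 1 / 6) / (c ^ 2 + 2 * c + 1 / 2) = x := by
  let q : ℝ → ℝ := fun c => (c ^ 2 + c + 1 / 6) / (c ^ 2 + 2 * c + 1 / 2)
  have denom_pos {c : ℝ} (hc : 0 ≤ c) : 0 < c ^ 2 + 2 * c + 1 / 2 := by positivity
  have pos : 0 < 1 - x := sub_pos.2 hx.2
  have le_q : x ≤ q (1 / (1 - x)) := by
    rw [le_div_iff₀ (denom_pos (by positivity))]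
    field_simp
    nlinarith [hx.1]
  have continuousOn_q : ContinuousOn q (Set.Icc 0 (1 / (1 - x))) :=
    .div (by fun_prop) (by fun_prop) fun c hc => (denom_pos hc.1).ne'
  obtain ⟨c, hc, rfl⟩ := intermediate_value_Ioc (by positivity) continuousOn_q
    ⟨by norm_num [q]; exact hx.1, le_q⟩
  exact ⟨c, hc.1, rfl⟩

end GraftTree

theorem Icc_subset_closure_treeDensities :
    Set.Icc (1 / 3 : ℝ) 1 ⊆ closure treeDensities := by
  rw [← closure_Ioo (by norm_num)]
  refine closure_minimal (fun x hx => ?_) isClosed_closure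
  obtain ⟨c, hc, rfl⟩ := GraftTree.exists_pos_div_eq hx
  exact GraftTree.div_mem_closure_treeDensities hc

namespace GraftTree

/-! ### Density of the values in `[1 / 2, 3 / 4]` -/

/-- The tree `t` with its root attached to the end of a path with `l` vertices, each of which
carries a leaf. The other end of the path is the new root. -/
def addCaterpillar (t : GraftTree) : ℕ → GraftTree
  | 0 => t
  | l + 1 => graft (graft single single) (t.addCaterpillar l)

lemma size_addCaterpillar (t : GraftTree) (l : ℕ) :
    (t.addCaterpillar l).size = t.size + 2 * l := by
  induction l with
  | zero => rfl
  | succ l ih => simp only [addCaterpillar, size, ih]; ring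

/-- A star with `k` leaves whose center is attached to the end of a caterpillar with `2 * l`
vertices. -/
def broom (k l : ℕ) : GraftTree := (single.addLeaves k).addCaterpillar l

section Broom

lemma sq_add_le_two_pow (k : ℕ) : (k : ℝ) ^ 2 + k + 2 ≤ 2 * 2 ^ k := by
  induction k with
  | zero => norm_num
  | succ k ih =>
    have : (k : ℝ) ≤ (k : ℝ) ^ 2 := mod_cast Nat.le_self_pow two_ne_zero k
    push_cast [pow_succ (2 : ℝ)]
    linarith

variable (k l : ℕ)

lemma broom_zero : broom k 0 = single.addLeaves k := rfl

lemma broom_succ : broom k (l + 1) = graft (graft single single) (broom k l) := rfl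

lemma count_broom_le : ((broom k l).count : ℝ) ≤ 2 * (broom k l).rootCount := by
  induction l with
  | zero =>
    simp only [broom_zero, count_addLeaves, rootCount_addLeaves, count, rootCount]
    push_cast
    linarith [sq_add_le_two_pow k, sq_nonneg (k - 1 : ℝ)]
  | succ l ih =>
    simp only [broom_succ, count, rootCount]
    push_cast
    linarith

lemma le_rootSum_broom :
    ((3 * l + k) / 2 - 1) * (broom k l).rootCount + (3 * l + k + 1) ≤
      ((broom k l).rootSum : ℝ) := by
  induction l with
  | zero =>
    simp only [broom_zero, rootSum_addLeaves, rootCount_addLeaves, rootSum, rootCount]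
    push_cast
    linarith [sq_add_le_two_pow k, sq_nonneg (k - 1 : ℝ)]
  | succ l ih =>
    simp only [broom_succ, rootSum, rootCount]
    push_cast
    linarith

lemma rootSum_broom_le :
    ((broom k l).rootSum : ℝ) ≤ ((3 * l + k) / 2 + 1) * (broom k l).rootCount := by
  induction l with
  | zero =>
    simp only [broom_zero, rootSum_addLeaves, rootCount_addLeaves, rootSum, rootCount]
    push_cast
    linarith
  | succ l ih =>
    have : (0 : ℝ) ≤ 3 * l + k := by positivity
    simp only [broom_succ, rootSum, rootCount]
    push_cast
    linarith

lemma le_sum_broom :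
    (3 * l + k) / 2 * ((broom k l).count : ℝ) - 5 * (broom k l).rootCount ≤ (broom k l).sum := by
  induction l with
  | zero =>
    simp only [broom_zero, rootCount_addLeaves, count_addLeaves, sum_addLeaves, count, sum,
      rootSum, rootCount]
    push_cast
    linarith [sq_add_le_two_pow k, sq_nonneg (k - 1 : ℝ)]
  | succ l ih =>
    have := le_rootSum_broom k l
    have := count_broom_le k l
    simp only [broom_succ, rootSum, rootCount, count, sum]
    push_cast
    linarith

lemma sum_broom_le :
    ((broom k l).sum : ℝ) ≤ (3 * l + k) / 2 * (broom k l).count + 2 * (broom k l).rootCount := by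
  induction l with
  | zero =>
    simp only [broom_zero, rootCount_addLeaves, count_addLeaves, sum_addLeaves, count, sum,
      rootSum, rootCount]
    push_cast
    linarith [sq_add_le_two_pow k, sq_nonneg (k - 1 : ℝ)]
  | succ l ih =>
    have := rootSum_broom_le k l
    have : (1 : ℝ) ≤ (broom k l).count := mod_cast (broom k l).count_pos
    have : (0 : ℝ) ≤ 3 * l + k := by positivity
    simp only [broom_succ, rootSum, rootCount, count, sum]
    push_cast
    linarith

/-- A typical subtree contains the whole spine and half of the `l + k` leaves. -/
lemma abs_sum_graft_broom_sub_le :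
    |((graft (broom k l) single).sum : ℝ) -
      (3 * l + k) / 2 * (graft (broom k l) single).count| ≤
      5 * (graft (broom k l) single).count := by
  have := le_rootSum_broom k l
  have := rootSum_broom_le k l
  have := le_sum_broom k l
  have := sum_broom_le k l
  have : (1 : ℝ) ≤ (broom k l).rootCount := mod_cast (broom k l).rootCount_pos
  have : ((broom k l).rootCount : ℝ) ≤ (broom k l).count := mod_cast (broom k l).rootCount_le_count
  have : (0 : ℝ) ≤ 3 * l + k := by positivity
  rw [abs_le]
  simp only [rootSum, rootCount, count, sum]
  push_cast
  constructor <;> linarith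

lemma size_graft_broom : (graft (broom k l) single).size = 2 * l + k + 2 := by
  simp only [broom, size, size_addCaterpillar, size_addLeaves]
  ring

variable {k}

lemma reduced_broom (hk : k ≠ 1) : (broom k l).Reduced ∧ (broom k l).numChildren ≠ 1 := by
  induction l with
  | zero =>
    exact ⟨Reduced.addLeaves k trivial, by simpa [broom_zero, numChildren_addLeaves]⟩
  | succ l ih => exact ⟨⟨⟨trivial, trivial, by simp⟩, ih⟩, by simp [broom_succ]⟩

lemma density_graft_broom_mem (hk : k ≠ 1) :
    density (graft (broom k l) single).graph ∈ seriesReducedTreeDensities := by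
  obtain ⟨reduced, numChildren_ne⟩ := reduced_broom l hk
  refine density_mem_seriesReducedTreeDensities (isTree_graph _) ?_ ?_
  · exact (isSeriesReduced_graph_iff _).2 ⟨⟨reduced, trivial, by simp⟩, by simpa⟩
  · rw [card_vertex]
    exact two_le_size (by simp)

variable (k)

lemma abs_density_graft_broom_sub_le (x : ℝ) :
    |density (graft (broom k l) single).graph - x| ≤
      (5 + |(3 * l + k) / 2 - x * (2 * l + k + 2)|) / (2 * l + k + 2) := by
  have abs_sum_le := abs_sum_graft_broom_sub_le k l
  have size_eq : ((graft (broom k l) single).size : ℝ) = 2 * l + k + 2 :=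
    mod_cast size_graft_broom k l
  have count_pos : (0 : ℝ) < (graft (broom k l) single).count := mod_cast count_pos _
  rw [density_graph, size_eq]
  generalize ((graft (broom k l) single).sum : ℝ) = S at *
  generalize ((graft (broom k l) single).count : ℝ) = N at *
  set m : ℝ := (3 * l + k) / 2
  set n : ℝ := 2 * l + k + 2
  have n_pos : 0 < n := by positivity
  calc |S / (n * N) - x| = |(S - m * N) / N + (m - x * n)| / n := by
        rw [← abs_of_pos n_pos, ← abs_div, abs_of_pos n_pos]
        congr 1
        field_simp
        ring
    _ ≤ (5 + |m - x * n|) / n := by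
        gcongr
        refine (abs_add_le _ _).trans (add_le_add_left ?_ _)
        rwa [abs_div, abs_of_pos count_pos, div_le_iff₀ count_pos]

end Broom

/-- Up to rounding, `l = (2 * x - 1) * j` and `k = (3 - 4 * x) * j` solve
`2 * l + k = j` and `(3 * l + k) / 2 = x * j`. -/
lemma exists_abs_sub_mul_size_le {x : ℝ} (hx : x ∈ Set.Icc (1 / 2 : ℝ) (3 / 4)) (j : ℕ) :
    ∃ k l : ℕ, k ≠ 1 ∧ (j : ℝ) ≤ 2 * l + k + 2 ∧
      |((3 * l + k) / 2 - x * (2 * l + k + 2) : ℝ)| ≤ 3 := by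
  obtain ⟨hx₁, hx₂⟩ := hx
  have hl : 0 ≤ (2 * x - 1) * j := mul_nonneg (by linarith) j.cast_nonneg
  have hk : 0 ≤ (3 - 4 * x) * j := mul_nonneg (by linarith) j.cast_nonneg
  refine ⟨⌊(3 - 4 * x) * j⌋₊ + 2, ⌊(2 * x - 1) * j⌋₊, by omega, ?_⟩
  have := Nat.floor_le hl
  have := Nat.floor_le hk
  have := Nat.lt_floor_add_one ((2 * x - 1) * j)
  have := Nat.lt_floor_add_one ((3 - 4 * x) * j)
  push_cast
  generalize (⌊(2 * x - 1) * j⌋₊ : ℝ) = l at *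
  generalize (⌊(3 - 4 * x) * j⌋₊ : ℝ) = k at *
  refine ⟨by linarith, abs_le.2 ⟨?_, ?_⟩⟩ <;> nlinarith

end GraftTree

theorem Icc_subset_closure_seriesReducedTreeDensities :
    Set.Icc (1 / 2 : ℝ) (3 / 4) ⊆ closure seriesReducedTreeDensities := by
  refine fun x hx => Metric.mem_closure_iff.2 fun ε hε => ?_
  obtain ⟨j, hj⟩ := exists_nat_gt (8 / ε)
  obtain ⟨k, l, hk, le_size, abs_sub_le⟩ := GraftTree.exists_abs_sub_mul_size_le hx j
  refine ⟨_, GraftTree.density_graft_broom_mem l hk, ?_⟩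
  have size_pos : (0 : ℝ) < 2 * l + k + 2 := by positivity
  rw [dist_comm, Real.dist_eq]
  refine (GraftTree.abs_density_graft_broom_sub_le k l x).trans_lt ?_
  rw [div_lt_comm₀ size_pos hε]
  refine lt_of_le_of_lt ?_ (hj.trans_le le_size)
  gcongr
  linarith

end SubtreeDensity

theorem mainTheorem4 :
    -- all values for arbitrary finite trees lie in `[1/3, 1]`
    (∀ {V : Type*} [Finite V] (T : SimpleGraph V), T.IsTree →
      SubtreeDensity.density T ∈ Set.Icc (1 / 3 : ℝ) 1) ∧
    -- these values are dense in `[1/3, 1]`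
    Set.Icc (1 / 3 : ℝ) 1 ⊆
      closure {d : ℝ | ∃ (n : ℕ) (T : SimpleGraph (Fin n)),
        T.IsTree ∧ SubtreeDensity.density T = d} ∧
    -- all values for series-reduced trees with more than one vertex lie in `[1/2, 3/4]`
    (∀ {V : Type*} [Finite V] (T : SimpleGraph V), T.IsTree →
      SubtreeDensity.IsSeriesReduced T → 2 ≤ Nat.card V →
      SubtreeDensity.density T ∈ Set.Icc (1 / 2 : ℝ) (3 / 4)) ∧
    -- these values are dense in `[1/2, 3/4]`
    Set.Icc (1 / 2 : ℝ) (3 / 4) ⊆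
      closure {d : ℝ | ∃ (n : ℕ) (T : SimpleGraph (Fin n)),
        T.IsTree ∧ SubtreeDensity.IsSeriesReduced T ∧ 2 ≤ n ∧
        SubtreeDensity.density T = d} :=
  ⟨fun _ => SubtreeDensity.density_mem_Icc, SubtreeDensity.Icc_subset_closure_treeDensities,
    fun _ => SubtreeDensity.density_mem_Icc_of_isSeriesReduced,
    SubtreeDensity.Icc_subset_closure_seriesReducedTreeDensities⟩
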